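/- Let $d\ge 1$ and let $\Omega\subset\mathbb R^d$ be a bounded open set (for instance a bounded smooth domain). Let $H^1(\Omega)$ be the space of $L^2(\Omega)$ functions with weak gradient in $[L^2(\Omega)]^d$, let $H^1_0(\Omega)$ be the closure of $C_c^\infty(\Omega)$ in $H^1(\Omega)$, let $H^{-1}(\Omega)=H^1_0(\Omega)'$, and let $H^{1/2}(\partial\Omega)=H^1(\Omega)/H^1_0(\Omega)$ be the space of boundary values $y_{|\partial\Omega}$ of functions $y\in H^1(\Omega)$ (for a bounded smooth domain this is the usual trace space). Let $L^\infty_F(\Omega)$ be a finite-dimensional subspace of $L^\infty(\Omega)$, of dimension $n_1$, identified with $\mathbb R^{n_1}$ by the choice of a basis. For $M>m>0$ let $$\mathcal U_{m,M}=\{u\in L^\infty_F(\Omega)\mid m\le u(x)\le M\text{ for a.e. }x\in\Omega\},$$ and assume that $\mathcal U_{m,M}\neq\emptyset$. Let $f\in H^{-1}(\Omega)$, $g\in H^{1/2}(\partial\Omega)$ and $y_d\in L^2(\Omega)$. Let $L\ge 1$ and let $n_2,\dots,n_{L+1}$ be dimensions. Let $\rho:\mathbb R\to\mathbb R$ be of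 class $C^2$ and $\gamma:\mathbb R^{n_{L+1}}\to\mathbb R$ be continuous (for instance smooth, or a norm). For a family of weights $w=(w_1,\dots,w_L)\in\mathcal W=\prod_{\ell=1}^L \mathrm{Aff}(\mathbb R^{n_\ell},\mathbb R^{n_{\ell+1}})$ let $$r(w,u)=w_L(\rho(w_{L-1}(\rho(\cdots\rho(w_1(u))))))\in\mathbb R^{n_{L+1}},$$ where $\rho$ is applied coordinatewise (and $r(w,u)=w_1(u)$ if $L=1$). Then for every $w\in\mathcal W$ the problem $$\min_{(y,u)\in H^1(\Omega)\times\mathcal U_{m,M}} J(y,u,w)=\tfrac12\|y-y_d\|_{L^2(\Omega)}^2+\gamma(r(w,u))$$ subject to $$-\operatorname{div}(u\nabla y)=f\ \text{ in } H^{-1}(\Omega),\qquad y_{|\partial\Omega}=g,$$ the first equation meaning $\int_\Omega u\,\nabla y\cdot\nabla\varphi\,dx=\langle f,\varphi\rangle$ for all $\varphi\in H^1_0(\Omega)$, admits a global minimizer: there is a pair $(y,u)\in H^1(\Omega)\times\mathcal U_{m,M}$ satisfying the constraints such that $J(y,u,w)\le J(y',u',w)$ for all pairs $(y',u')\in H^1(\Omega)\times\mathcal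 U_{m,M}$ satisfying the constraints. -/

import Mathlib

open MeasureTheory
open scoped ENNReal ContDiff

noncomputable section

namespace Conductivity

variable {d : ℕ}

/-- Lebesgue measure on `Ω ⊆ ℝ^d`. -/
abbrev vol (Ω : Set (EuclideanSpace ℝ (Fin d))) : Measure (EuclideanSpace ℝ (Fin d)) :=
  volume.restrict Ω

/-- `L²(Ω)`. -/
abbrev L2 (Ω : Set (EuclideanSpace ℝ (Fin d))) : Type := Lp ℝ 2 (vol Ω)

/-- `[L²(Ω)]^d`. -/
abbrev L2vec (Ω : Set (EuclideanSpace ℝ (Fin d))) : Type :=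
  Lp (EuclideanSpace ℝ (Fin d)) 2 (vol Ω)

/-- `L^∞(Ω)`. -/
abbrev Linf (Ω : Set (EuclideanSpace ℝ (Fin d))) : Type := Lp ℝ ∞ (vol Ω)

/-- `φ ∈ C_c^∞(Ω)`. -/
structure IsTest (Ω : Set (EuclideanSpace ℝ (Fin d))) (φ : EuclideanSpace ℝ (Fin d) → ℝ) :
    Prop where
  smooth : ContDiff ℝ ∞ φ
  compact : HasCompactSupport φ
  supp : tsupport φ ⊆ Ω

/-- The partial derivative `∂ᵢ φ`. -/
def partialDeriv (i : Fin d) (φ : EuclideanSpace ℝ (Fin d) → ℝ) (x : EuclideanSpace ℝ (Fin d)) :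
    ℝ :=
  fderiv ℝ φ x (EuclideanSpace.single i 1)

/-- `v` is the weak gradient of `y` in `Ω`. -/
def HasWeakGradient (Ω : Set (EuclideanSpace ℝ (Fin d))) (y : L2 Ω) (v : L2vec Ω) : Prop :=
  ∀ φ, IsTest Ω φ → ∀ i : Fin d,
    ∫ x in Ω, y x * partialDeriv i φ x = - ∫ x in Ω, v x i * φ x

theorem IsTest.memLp {Ω : Set (EuclideanSpace ℝ (Fin d))} {φ : EuclideanSpace ℝ (Fin d) → ℝ}
    (h : IsTest Ω φ) : MemLp φ 2 (vol Ω) :=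
  (h.smooth.continuous.memLp_of_hasCompactSupport h.compact).restrict Ω

theorem IsTest.partialDeriv_memLp {Ω : Set (EuclideanSpace ℝ (Fin d))}
    {φ : EuclideanSpace ℝ (Fin d) → ℝ} (h : IsTest Ω φ) (i : Fin d) :
    MemLp (partialDeriv i φ) 2 (vol Ω) :=
  (((h.smooth.continuous_fderiv (by simp)).clm_apply
    continuous_const).memLp_of_hasCompactSupport (h.compact.fderiv_apply ℝ _)).restrict Ω

theorem memLp_coord {Ω : Set (EuclideanSpace ℝ (Fin d))} (v : L2vec Ω) (i : Fin d) :
    MemLp (fun x => v x i) 2 (vol Ω) :=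
  (EuclideanSpace.proj (𝕜 := ℝ) i : EuclideanSpace ℝ (Fin d) →L[ℝ] ℝ).comp_memLp' (Lp.memLp v)

theorem HasWeakGradient.zero (Ω : Set (EuclideanSpace ℝ (Fin d))) :
    HasWeakGradient Ω 0 0 := by
  intro φ _ i
  have h1 : ∫ x in Ω, (0 : L2 Ω) x * partialDeriv i φ x = 0 := by
    rw [← integral_zero (μ := vol Ω) (G := ℝ)]
    refine integral_congr_ae ?_
    filter_upwards [Lp.coeFn_zero ℝ 2 (vol Ω)] with x hx
    rw [hx]
    simp
  have h2 : ∫ x in Ω, (0 : L2vec Ω) x i * φ x = 0 := by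
    rw [← integral_zero (μ := vol Ω) (G := ℝ)]
    refine integral_congr_ae ?_
    filter_upwards [Lp.coeFn_zero (EuclideanSpace ℝ (Fin d)) 2 (vol Ω)] with x hx
    rw [hx]
    simp
  rw [h1, h2, neg_zero]

theorem HasWeakGradient.add {Ω : Set (EuclideanSpace ℝ (Fin d))} {y z : L2 Ω} {v w : L2vec Ω}
    (h : HasWeakGradient Ω y v) (k : HasWeakGradient Ω z w) :
    HasWeakGradient Ω (y + z) (v + w) := by
  intro φ hφ i
  have h1 : ∫ x in Ω, (y + z) x * partialDeriv i φ x =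
      ∫ x in Ω, y x * partialDeriv i φ x + z x * partialDeriv i φ x := by
    refine integral_congr_ae ?_
    filter_upwards [Lp.coeFn_add y z] with x hx
    rw [hx]
    simp [add_mul]
  have h2 : ∫ x in Ω, (v + w) x i * φ x = ∫ x in Ω, v x i * φ x + w x i * φ x := by
    refine integral_congr_ae ?_
    filter_upwards [Lp.coeFn_add v w] with x hx
    rw [hx]
    simp [add_mul]
  have i1 : Integrable (fun x => y x * partialDeriv i φ x) (vol Ω) :=
    (Lp.memLp y).integrable_mul (hφ.partialDeriv_memLp i)
  have i2 : Integrable (fun x => z x * partialDeriv i φ x) (vol Ω) :=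
    (Lp.memLp z).integrable_mul (hφ.partialDeriv_memLp i)
  have i3 : Integrable (fun x => v x i * φ x) (vol Ω) :=
    (memLp_coord v i).integrable_mul hφ.memLp
  have i4 : Integrable (fun x => w x i * φ x) (vol Ω) :=
    (memLp_coord w i).integrable_mul hφ.memLp
  rw [h1, h2, integral_add i1 i2, integral_add i3 i4, h φ hφ i, k φ hφ i]
  ring

theorem HasWeakGradient.smul {Ω : Set (EuclideanSpace ℝ (Fin d))} {y : L2 Ω} {v : L2vec Ω}
    (c : ℝ) (h : HasWeakGradient Ω y v) : HasWeakGradient Ω (c • y) (c • v) := by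
  intro φ hφ i
  have h1 : ∫ x in Ω, (c • y) x * partialDeriv i φ x =
      ∫ x in Ω, c * (y x * partialDeriv i φ x) := by
    refine integral_congr_ae ?_
    filter_upwards [Lp.coeFn_smul c y] with x hx
    simp [hx, mul_assoc]
  have h2 : ∫ x in Ω, (c • v) x i * φ x = ∫ x in Ω, c * (v x i * φ x) := by
    refine integral_congr_ae ?_
    filter_upwards [Lp.coeFn_smul c v] with x hx
    simp [hx, mul_assoc]
  rw [h1, h2, integral_const_mul, integral_const_mul, h φ hφ i]
  ring

/-- The Sobolev space `H¹(Ω)`: the functions of `L²(Ω)` with a weak gradient in `[L²(Ω)]^d`. An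
element is stored as the pair `(y, ∇y)`, the second entry being determined by the first; the norm
is `(‖y‖² + ‖∇y‖²)^{1/2}`. -/
def H1 (Ω : Set (EuclideanSpace ℝ (Fin d))) : Submodule ℝ (WithLp 2 (L2 Ω × L2vec Ω)) where
  carrier := {p | HasWeakGradient Ω p.fst p.snd}
  zero_mem' := HasWeakGradient.zero Ω
  add_mem' h k := HasWeakGradient.add h k
  smul_mem' c _ h := HasWeakGradient.smul c h

/-- The embedding `H¹(Ω) → L²(Ω)`. -/
def H1.val {Ω : Set (EuclideanSpace ℝ (Fin d))} (y : H1 Ω) : L2 Ω := y.1.fst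

/-- The weak gradient `H¹(Ω) → [L²(Ω)]^d`. -/
def H1.grad {Ω : Set (EuclideanSpace ℝ (Fin d))} (y : H1 Ω) : L2vec Ω := y.1.snd

/-- `C_c^∞(Ω)` as a subspace of `H¹(Ω)`. -/
def testSubmodule (Ω : Set (EuclideanSpace ℝ (Fin d))) : Submodule ℝ (H1 Ω) where
  carrier := {y | ∃ φ, IsTest Ω φ ∧ (∀ᵐ x ∂vol Ω, H1.val y x = φ x) ∧
    ∀ᵐ x ∂vol Ω, ∀ i, H1.grad y x i = partialDeriv i φ x}
  zero_mem' := by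
    refine ⟨0, ⟨contDiff_const, HasCompactSupport.zero, by simp [tsupport]⟩, ?_, ?_⟩
    · filter_upwards [Lp.coeFn_zero ℝ 2 (vol Ω)] with x hx
      exact hx
    · filter_upwards [Lp.coeFn_zero (EuclideanSpace ℝ (Fin d)) 2 (vol Ω)] with x hx i
      have : (H1.grad (0 : H1 Ω)) x = 0 := hx
      simp [this, partialDeriv]
  add_mem' := by
    rintro y z ⟨φ, hφ, hy, hy'⟩ ⟨ψ, hψ, hz, hz'⟩
    refine ⟨φ + ψ, ⟨hφ.smooth.add hψ.smooth, hφ.compact.add hψ.compact,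
      (tsupport_add φ ψ).trans (Set.union_subset hφ.supp hψ.supp)⟩, ?_, ?_⟩
    · filter_upwards [Lp.coeFn_add (H1.val y) (H1.val z), hy, hz] with x hx h k
      have : H1.val (y + z) x = (⇑(H1.val y) + ⇑(H1.val z)) x := hx
      simp [this, h, k]
    · filter_upwards [Lp.coeFn_add (H1.grad y) (H1.grad z), hy', hz'] with x hx h k i
      have : H1.grad (y + z) x = (⇑(H1.grad y) + ⇑(H1.grad z)) x := hx
      have e : fderiv ℝ (φ + ψ) x = fderiv ℝ φ x + fderiv ℝ ψ x :=
        fderiv_add (hφ.smooth.differentiable (by simp) x) (hψ.smooth.differentiable (by simp) x)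
      simp only [this, partialDeriv, e]
      simp [h, k, partialDeriv]
  smul_mem' := by
    rintro c y ⟨φ, hφ, hy, hy'⟩
    refine ⟨c • φ, ⟨hφ.smooth.const_smul c, hφ.compact.smul_left (f := fun _ => c),
      (tsupport_smul_subset_right (fun _ => c) φ).trans hφ.supp⟩, ?_, ?_⟩
    · filter_upwards [Lp.coeFn_smul c (H1.val y), hy] with x hx h
      have : H1.val (c • y) x = (c • ⇑(H1.val y)) x := hx
      simp [this, h]
    · filter_upwards [Lp.coeFn_smul c (H1.grad y), hy'] with x hx h i
      have : H1.grad (c • y) x = (c • ⇑(H1.grad y)) x := hx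
      have e : fderiv ℝ (c • φ) x = c • fderiv ℝ φ x :=
        fderiv_const_smul (hφ.smooth.differentiable (by simp) x) c
      simp only [this, partialDeriv, e]
      simp [h, partialDeriv]

/-- `H¹₀(Ω)`: the closure of `C_c^∞(Ω)` in `H¹(Ω)`. -/
def H10 (Ω : Set (EuclideanSpace ℝ (Fin d))) : Submodule ℝ (H1 Ω) :=
  (testSubmodule Ω).topologicalClosure

/-- `H⁻¹(Ω)`: the topological dual of `H¹₀(Ω)`. -/
abbrev Hneg1 (Ω : Set (EuclideanSpace ℝ (Fin d))) : Type := H10 Ω →L[ℝ] ℝ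

/-- `H^{1/2}(∂Ω)`: the space of boundary values of `H¹(Ω)` functions, two functions having the same
boundary values when their difference lies in `H¹₀(Ω)`. -/
abbrev HHalf (Ω : Set (EuclideanSpace ℝ (Fin d))) : Type := H1 Ω ⧸ H10 Ω

/-- The trace `y ↦ y|_{∂Ω}`. -/
def trace (Ω : Set (EuclideanSpace ℝ (Fin d))) : H1 Ω →ₗ[ℝ] HHalf Ω := (H10 Ω).mkQ

/-- `y` solves `-div(u ∇y) = f` in `H⁻¹(Ω)` and `y = g` on `∂Ω`. -/
def IsState {Ω : Set (EuclideanSpace ℝ (Fin d))} (f : Hneg1 Ω) (g : HHalf Ω) (u : Linf Ω)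
    (y : H1 Ω) : Prop :=
  (∀ φ : H10 Ω, ∫ x in Ω, u x * inner ℝ (H1.grad y x) (H1.grad (φ : H1 Ω) x) = f φ) ∧
    trace Ω y = g

/-- `𝒰_{m,M}`: the elements `u` of the given subspace of `L^∞(Ω)` with `m ≤ u ≤ M` a.e. -/
def admissible {Ω : Set (EuclideanSpace ℝ (Fin d))} (F : Submodule ℝ (Linf Ω)) (m M : ℝ) : Set F :=
  {u | ∀ᵐ x ∂vol Ω, m ≤ (u : Linf Ω) x ∧ (u : Linf Ω) x ≤ M}

/-- The weights of a network with `N` layers and layer dimensions `n 0, …, n N`: one affine map per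
layer. -/
abbrev Weights (N : ℕ) (n : ℕ → ℕ) : Type :=
  ∀ l : Fin N, (Fin (n l) → ℝ) →ᵃ[ℝ] (Fin (n (l + 1)) → ℝ)

/-- The first `l + 1` layers of the network: `w_{l+1}(ρ(w_l(ρ(… ρ(w_1(z))))))`, with `ρ` applied
coordinatewise. -/
def partialNetwork {N : ℕ} {n : ℕ → ℕ} (ρ : ℝ → ℝ) (w : Weights N n) :
    (l : ℕ) → l < N → (Fin (n 0) → ℝ) → (Fin (n (l + 1)) → ℝ)
  | 0, h, z => w ⟨0, h⟩ z
  | l + 1, h, z => w ⟨l + 1, h⟩ fun i => ρ (partialNetwork ρ w l (Nat.lt_of_succ_lt h) z i)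

/-- The feedforward network with `L + 1 ≥ 1` layers. -/
def network {L : ℕ} {n : ℕ → ℕ} (ρ : ℝ → ℝ) (w : Weights (L + 1) n) (z : Fin (n 0) → ℝ) :
    Fin (n (L + 1)) → ℝ :=
  partialNetwork ρ w L (Nat.lt_succ_self L) z

/-- The regularizer `r(w, ·)` on the finite-dimensional control space `F`, which is identified with
`ℝ^{n 0}` through the basis `b`. -/
def regularizer {Ω : Set (EuclideanSpace ℝ (Fin d))} {F : Submodule ℝ (Linf Ω)} {L : ℕ}
    {n : ℕ → ℕ} (b : Module.Basis (Fin (n 0)) ℝ F) (ρ : ℝ → ℝ) (w : Weights (L + 1) n) (u : F) :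
    Fin (n (L + 1)) → ℝ :=
  network ρ w (b.equivFun u)

/-- The pairs `(y, u) ∈ H¹(Ω) × 𝒰_{m,M}` satisfying the state equation. -/
def feasible {Ω : Set (EuclideanSpace ℝ (Fin d))} (F : Submodule ℝ (Linf Ω)) (m M : ℝ)
    (f : Hneg1 Ω) (g : HHalf Ω) : Set (H1 Ω × F) :=
  {p | p.2 ∈ admissible F m M ∧ IsState f g (p.2 : Linf Ω) p.1}

/-- `J(y, u, w) = ½ ‖y - y_d‖²_{L²(Ω)} + γ(r(w, u))`. -/
def cost {Ω : Set (EuclideanSpace ℝ (Fin d))} {F : Submodule ℝ (Linf Ω)} {L : ℕ} {n : ℕ → ℕ}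
    (b : Module.Basis (Fin (n 0)) ℝ F) (ρ : ℝ → ℝ) (γ : (Fin (n (L + 1)) → ℝ) → ℝ) (yd : L2 Ω)
    (w : Weights (L + 1) n) (p : H1 Ω × F) : ℝ :=
  1 / 2 * ‖H1.val p.1 - yd‖ ^ 2 + γ (regularizer b ρ w p.2)

end Conductivity

end

noncomputable section

namespace Conductivity

/-! The state is a continuous function of the control on a compact set of controls, so the reduced
cost attains its minimum. No minimizing sequence or weak convergence is needed, because the controls
live in a finite-dimensional space.

Solvability: lift `g` to some `G` in `H1 Ω` and look for `y = G + z` with `z` in `H10 Ω`. The form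
in `z` is coercive by the Poincaré inequality and `u ≥ m > 0` (`exists_coercive`), so Lax–Milgram
gives a unique `z`. The operator depends linearly on `u` in the `L^∞` norm, and operator inversion
is continuous at invertible elements, hence so is the control-to-state map (`exists_stateMap`).

Compactness: `admissible` is the trace on `F` of a closed `L^∞` ball (`isCompact_admissible`). -/

/-! ### Abstract coercive problems with a parameter -/

/-- A coercive bounded operator on a real Hilbert space is invertible. -/
theorem isUnit_of_coercive {V : Type*} [NormedAddCommGroup V] [InnerProductSpace ℝ V]
    [CompleteSpace V] (A : V →L[ℝ] V) {c : ℝ} (hc : 0 < c)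
    (h : ∀ v, c * ‖v‖ ^ 2 ≤ inner ℝ (A v) v) : IsUnit A := by
  have hB : IsCoercive ((innerSL ℝ).comp A) := by
    refine ⟨c, hc, fun v => ?_⟩
    have := h v
    simp only [ContinuousLinearMap.comp_apply, innerSL_apply_apply]
    nlinarith
  have hA : A = (hB.continuousLinearEquivOfBilin : V →L[ℝ] V) := by
    ext1 v
    exact hB.unique_continuousLinearEquivOfBilin fun w => by simp
  rw [hA]
  exact (ContinuousLinearEquiv.toUnit hB.continuousLinearEquivOfBilin).isUnit

/-- Coercive linear problems `⟪T u (G + D z), D φ⟫ = f φ` are uniquely solvable, and the solution `z`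
depends continuously on the coefficient `u`. -/
theorem exists_continuousAt_solution {V W X : Type*} [NormedAddCommGroup V]
    [InnerProductSpace ℝ V] [CompleteSpace V] [NormedAddCommGroup W] [InnerProductSpace ℝ W]
    [CompleteSpace W] [NormedAddCommGroup X] [NormedSpace ℝ X] (D : V →L[ℝ] W)
    (T : X →L[ℝ] W →L[ℝ] W) (f : V →L[ℝ] ℝ) (G : W) :
    ∃ S : X → V, ∀ u : X, ∀ c : ℝ, 0 < c → (∀ z, c * ‖z‖ ^ 2 ≤ inner ℝ (T u (D z)) (D z)) →
      ContinuousAt S u ∧ ∀ z, (∀ φ, inner ℝ (T u (G + D z)) (D φ) = f φ) ↔ z = S u := by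
  -- By adjunction and Riesz representation the variational problem becomes the operator equation `A
  -- u z = b u`.
  set A : X → V →L[ℝ] V := fun u => D.adjoint.comp ((T u).comp D) with hA
  set b : X → V := fun u => (InnerProductSpace.toDual ℝ V).symm f - D.adjoint (T u G) with hb
  have hAc : Continuous A := continuous_const.clm_comp (T.continuous.clm_comp continuous_const)
  have hbc : Continuous b :=
    continuous_const.sub (D.adjoint.continuous.comp (T.continuous.clm_apply continuous_const))
  -- `Ring.inverse` is zero at non-units, so the solution map is total; only coercive `u` matter.
  refine ⟨fun u => Ring.inverse (A u) (b u), fun u c hc hcoer => ?_⟩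
  obtain ⟨U, hU⟩ : IsUnit (A u) := isUnit_of_coercive _ hc fun z => by
    simpa [hA, ContinuousLinearMap.adjoint_inner_left] using hcoer z
  have hinv : ContinuousAt (fun u => Ring.inverse (A u)) u := by
    have := NormedRing.inverse_continuousAt U
    rw [hU] at this
    exact ContinuousAt.comp (g := Ring.inverse) this hAc.continuousAt
  refine ⟨hinv.clm_apply hbc.continuousAt, fun z => ?_⟩
  have heq : (∀ φ, inner ℝ (T u (G + D z)) (D φ) = f φ) ↔ A u z = b u := by
    rw [hb, eq_sub_iff_add_eq, ext_iff_inner_right ℝ]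
    refine forall_congr' fun φ => ?_
    simp [hA, inner_add_left, ContinuousLinearMap.adjoint_inner_left, add_comm]
  have hu : IsUnit (A u) := ⟨U, hU⟩
  rw [heq]
  constructor
  · intro h
    change z = Ring.inverse (A u) (b u)
    rw [← h, ← mul_apply_eq_comp, Ring.inverse_mul_cancel _ hu]
    rfl
  · rintro rfl
    change A u (Ring.inverse (A u) (b u)) = b u
    rw [← mul_apply_eq_comp, Ring.mul_inverse_cancel _ hu]
    rfl

/-! ### Completeness of the Sobolev spaces -/

variable {d : ℕ} {Ω : Set (EuclideanSpace ℝ (Fin d))}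

/-- The embedding `H¹(Ω) → L²(Ω)` as a continuous linear map. -/
def valL (Ω : Set (EuclideanSpace ℝ (Fin d))) : H1 Ω →L[ℝ] L2 Ω :=
  (WithLp.fstL 2 ℝ (L2 Ω) (L2vec Ω)).comp (H1 Ω).subtypeL

/-- The weak gradient `H¹(Ω) → [L²(Ω)]^d` as a continuous linear map. -/
def gradL (Ω : Set (EuclideanSpace ℝ (Fin d))) : H1 Ω →L[ℝ] L2vec Ω :=
  (WithLp.sndL 2 ℝ (L2 Ω) (L2vec Ω)).comp (H1 Ω).subtypeL

theorem H1.norm_sq_eq (y : H1 Ω) : ‖y‖ ^ 2 = ‖H1.val y‖ ^ 2 + ‖H1.grad y‖ ^ 2 :=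
  WithLp.prod_norm_sq_eq_of_L2 y.1

theorem IsTest.memLp_single {φ : EuclideanSpace ℝ (Fin d) → ℝ} (h : IsTest Ω φ) (i : Fin d) :
    MemLp (fun x => EuclideanSpace.single i (φ x)) 2 (vol Ω) := by
  have := ((ContinuousLinearMap.id ℝ ℝ).smulRight
    (EuclideanSpace.single i (1 : ℝ))).comp_memLp' h.memLp
  refine this.ae_eq (Filter.Eventually.of_forall fun x => ?_)
  ext j
  simp [PiLp.single_apply]

/-- Pairing with fixed `L²` elements is continuous, so in this form each test function imposes a
closed condition on `(y, v)`; this makes `H1 Ω` closed, hence complete. -/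
theorem hasWeakGradient_iff_inner (y : L2 Ω) (v : L2vec Ω) :
    HasWeakGradient Ω y v ↔ ∀ φ, ∀ h : IsTest Ω φ, ∀ i : Fin d,
      inner ℝ y ((h.partialDeriv_memLp i).toLp _) = - inner ℝ v ((h.memLp_single i).toLp _) := by
  refine forall_congr' fun φ => forall_congr' fun h => forall_congr' fun i => ?_
  have h1 : inner ℝ y ((h.partialDeriv_memLp i).toLp _) =
      ∫ x in Ω, y x * partialDeriv i φ x := by
    rw [L2.inner_def]
    refine integral_congr_ae ?_
    filter_upwards [(h.partialDeriv_memLp i).coeFn_toLp] with x hx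
    rw [hx]
    simp [mul_comm]
  have h2 : inner ℝ v ((h.memLp_single i).toLp _) = ∫ x in Ω, v x i * φ x := by
    rw [L2.inner_def]
    refine integral_congr_ae ?_
    filter_upwards [(h.memLp_single i).coeFn_toLp] with x hx
    rw [hx, EuclideanSpace.inner_single_right]
    simp [mul_comm]
  rw [h1, h2]

theorem isClosed_H1 (Ω : Set (EuclideanSpace ℝ (Fin d))) :
    IsClosed (H1 Ω : Set (WithLp 2 (L2 Ω × L2vec Ω))) := by
  have : (H1 Ω : Set (WithLp 2 (L2 Ω × L2vec Ω))) =
      {p | ∀ φ, ∀ h : IsTest Ω φ, ∀ i : Fin d,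
        inner ℝ (WithLp.fstL 2 ℝ (L2 Ω) (L2vec Ω) p) ((h.partialDeriv_memLp i).toLp _) =
          - inner ℝ (WithLp.sndL 2 ℝ (L2 Ω) (L2vec Ω) p) ((h.memLp_single i).toLp _)} := by
    ext p
    exact hasWeakGradient_iff_inner p.fst p.snd
  rw [this]
  simp only [Set.ofPred_forall]
  refine isClosed_iInter fun φ => isClosed_iInter fun h => isClosed_iInter fun i =>
    isClosed_eq ?_ ?_
  · exact (ContinuousLinearMap.continuous _).inner continuous_const
  · exact ((ContinuousLinearMap.continuous _).inner continuous_const).neg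

instance : CompleteSpace (H1 Ω) := (isClosed_H1 Ω).completeSpace_coe

instance : CompleteSpace (H10 Ω) :=
  (testSubmodule Ω).isClosed_topologicalClosure.completeSpace_coe

/-! ### Poincaré inequality -/

theorem norm_sq_eq_integral {E : Type*} [NormedAddCommGroup E] [InnerProductSpace ℝ E]
    (v : Lp E 2 (vol Ω)) : ‖v‖ ^ 2 = ∫ x in Ω, ‖v x‖ ^ 2 := by
  rw [← real_inner_self_eq_norm_sq, L2.inner_def]
  simp

/-- The Poincaré inequality in the direction `i` for test functions. -/
theorem IsTest.integral_sq_le {φ : EuclideanSpace ℝ (Fin d) → ℝ} (h : IsTest Ω φ) {R : ℝ}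
    (hR : ∀ x ∈ Ω, ‖x‖ ≤ R) (i : Fin d) :
    ∫ x in Ω, φ x ^ 2 ≤ 4 * R ^ 2 * ∫ x in Ω, partialDeriv i φ x ^ 2 := by
  have hcd : Continuous (partialDeriv i φ) :=
    (h.smooth.continuous_fderiv (by simp)).clm_apply continuous_const
  have hc : Continuous φ := h.smooth.continuous
  have hsupp : ∀ x, x ∉ Ω → φ x = 0 := fun x hx =>
    image_eq_zero_of_notMem_tsupport fun h' => hx (h.supp h')
  have hsupp' : ∀ x, x ∉ Ω → partialDeriv i φ x = 0 := fun x hx => by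
    have : x ∉ tsupport (fderiv ℝ φ) := fun h' => hx (h.supp (tsupport_fderiv_subset ℝ h'))
    simp [partialDeriv, image_eq_zero_of_notMem_tsupport this]
  have hd : ∀ x, fderiv ℝ (fun x => φ x ^ 2) x (EuclideanSpace.single i 1) =
      2 * φ x * partialDeriv i φ x := fun x => by
    have := ((h.smooth.differentiable (by simp) x).hasFDerivAt.pow 2).fderiv
    rw [this]
    simp [partialDeriv]
  have hp : ∀ x, fderiv ℝ (fun x : EuclideanSpace ℝ (Fin d) => x i) x
      (EuclideanSpace.single i 1) = 1 := fun x => by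
    have := (EuclideanSpace.proj (𝕜 := ℝ) i : EuclideanSpace ℝ (Fin d) →L[ℝ] ℝ).hasFDerivAt (x := x)
    have e : fderiv ℝ (fun x : EuclideanSpace ℝ (Fin d) => x i) x = EuclideanSpace.proj i :=
      this.fderiv
    rw [e]
    simp
  have hxi : Continuous fun x : EuclideanSpace ℝ (Fin d) => x i :=
    (EuclideanSpace.proj (𝕜 := ℝ) i : EuclideanSpace ℝ (Fin d) →L[ℝ] ℝ).continuous
  have hcomp : ∀ g : EuclideanSpace ℝ (Fin d) → ℝ, (∀ x, φ x = 0 → g x = 0) →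
      HasCompactSupport g := fun g hg =>
    h.compact.mono fun x hx hx' => hx (hg x hx')
  have i0 : Integrable (fun x => φ x ^ 2) volume :=
    (hc.pow 2).integrable_of_hasCompactSupport (hcomp _ fun x hx => by simp [hx])
  have i1 : Integrable (fun x => x i * (2 * φ x * partialDeriv i φ x)) volume :=
    (hxi.mul ((continuous_const.mul hc).mul hcd)).integrable_of_hasCompactSupport
      (hcomp _ fun x hx => by simp [hx])
  have i2 : Integrable (fun x => partialDeriv i φ x ^ 2) volume := by
    refine (hcd.pow 2).integrable_of_hasCompactSupport ?_
    exact (h.compact.fderiv_apply ℝ _).mono fun x hx hx' => hx (by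
      have : partialDeriv i φ x = 0 := hx'
      simp [this])
  -- As `∂ᵢ xᵢ = 1`, integration by parts against `xᵢ` gives `∫ φ² = -∫ 2 xᵢ φ ∂ᵢφ`.
  have key := integral_mul_fderiv_eq_neg_fderiv_mul_of_integrable (μ := volume)
    (f := fun x : EuclideanSpace ℝ (Fin d) => x i) (g := fun x => φ x ^ 2)
    (v := EuclideanSpace.single i 1)
    (by simpa only [hp, one_mul] using i0) (by simpa only [hd] using i1)
    ((hxi.mul (hc.pow 2)).integrable_of_hasCompactSupport (hcomp _ fun x hx => by simp [hx]))
    (fun x _ => (EuclideanSpace.proj (𝕜 := ℝ) i :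
      EuclideanSpace ℝ (Fin d) →L[ℝ] ℝ).differentiableAt)
    (fun x _ => (h.smooth.differentiable (by simp) x).pow 2)
  simp only [hp, hd, one_mul] at key
  -- Young's inequality with weight `1/2`, so that half of `∫ φ²` can be absorbed on the left,
  -- leaving the constant `4 R²`. The bound `|xᵢ| ≤ R` holds only on `Ω`; outside, both sides
  -- vanish.
  have hle : -∫ x, x i * (2 * φ x * partialDeriv i φ x) ≤
      ∫ x, (1 / 2 * φ x ^ 2 + 2 * R ^ 2 * partialDeriv i φ x ^ 2) := by
    rw [← integral_neg]
    refine integral_mono i1.neg ((i0.const_mul _).add (i2.const_mul _)) fun x => ?_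
    by_cases hx : x ∈ Ω
    · have h1 : |x i| ≤ R := (PiLp.norm_apply_le x i).trans (hR x hx)
      have h2 : x i ^ 2 ≤ R ^ 2 := sq_le_sq' (abs_le.1 h1).1 (abs_le.1 h1).2
      have h3 := mul_le_mul_of_nonneg_right h2 (sq_nonneg (partialDeriv i φ x))
      change -(x i * (2 * φ x * partialDeriv i φ x)) ≤ _
      nlinarith [sq_nonneg (φ x + 2 * x i * partialDeriv i φ x)]
    · simp [hsupp x hx, hsupp' x hx]
  rw [integral_add (i0.const_mul _) (i2.const_mul _), integral_const_mul,
    integral_const_mul] at hle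
  rw [setIntegral_eq_integral_of_forall_compl_eq_zero fun x hx => by simp [hsupp x hx],
    setIntegral_eq_integral_of_forall_compl_eq_zero fun x hx => by simp [hsupp' x hx]]
  linarith

/-- The Poincaré inequality on `H¹₀(Ω)` for bounded `Ω`. -/
theorem H10.norm_val_sq_le (hd : 1 ≤ d) {R : ℝ} (hR : ∀ x ∈ Ω, ‖x‖ ≤ R) (y : H10 Ω) :
    ‖H1.val (y : H1 Ω)‖ ^ 2 ≤ 4 * R ^ 2 * ‖H1.grad (y : H1 Ω)‖ ^ 2 := by
  have hcl : IsClosed {y : H1 Ω | ‖valL Ω y‖ ^ 2 ≤ 4 * R ^ 2 * ‖gradL Ω y‖ ^ 2} :=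
    isClosed_le ((valL Ω).continuous.norm.pow 2)
      (continuous_const.mul ((gradL Ω).continuous.norm.pow 2))
  -- Both norms are continuous on `H1 Ω`, so the estimate passes from test functions to their
  -- closure.
  refine closure_minimal (s := (testSubmodule Ω : Set (H1 Ω))) ?_ hcl y.2
  rintro z ⟨φ, hφ, hv, hg⟩
  have e1 : ‖H1.val z‖ ^ 2 = ∫ x in Ω, φ x ^ 2 := by
    rw [norm_sq_eq_integral]
    refine integral_congr_ae ?_
    filter_upwards [hv] with x hx
    simp [hx]
  have e2 : ∫ x in Ω, partialDeriv ⟨0, hd⟩ φ x ^ 2 ≤ ‖H1.grad z‖ ^ 2 := by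
    rw [norm_sq_eq_integral]
    refine integral_mono_ae (hφ.partialDeriv_memLp _).integrable_sq
      (Lp.memLp (H1.grad z)).norm.integrable_sq ?_
    filter_upwards [hg] with x hx
    rw [← hx, EuclideanSpace.norm_sq_eq]
    simpa using Finset.single_le_sum (f := fun j => ‖H1.grad z x j‖ ^ 2)
      (fun j _ => sq_nonneg _) (Finset.mem_univ (⟨0, hd⟩ : Fin d))
  change ‖H1.val z‖ ^ 2 ≤ 4 * R ^ 2 * ‖H1.grad z‖ ^ 2
  rw [e1]
  exact (hφ.integral_sq_le hR ⟨0, hd⟩).trans (mul_le_mul_of_nonneg_left e2 (by positivity))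

/-! ### State equation and control-to-state map -/

/-- Multiplication of `L²` vector fields by `L^∞` functions. -/
def mulL (Ω : Set (EuclideanSpace ℝ (Fin d))) : Linf Ω →L[ℝ] L2vec Ω →L[ℝ] L2vec Ω :=
  (ContinuousLinearMap.lsmul ℝ ℝ).holderL (vol Ω) ∞ 2 2

theorem inner_mulL (u : Linf Ω) (v w : L2vec Ω) :
    inner ℝ (mulL Ω u v) w = ∫ x in Ω, u x * inner ℝ (v x) (w x) := by
  rw [L2.inner_def]
  refine integral_congr_ae ?_
  filter_upwards [(ContinuousLinearMap.lsmul ℝ ℝ).coeFn_holder (r := 2) u v] with x hx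
  have : mulL Ω u v x = u x • v x := hx
  rw [this, real_inner_smul_left]

theorem mul_norm_sq_le_inner_mulL {m : ℝ} {u : Linf Ω} (hu : ∀ᵐ x ∂vol Ω, m ≤ u x) (v : L2vec Ω) :
    m * ‖v‖ ^ 2 ≤ inner ℝ (mulL Ω u v) v := by
  rw [norm_sq_eq_integral, L2.inner_def, ← integral_const_mul]
  refine integral_mono_ae ((Lp.memLp v).norm.integrable_sq.const_mul m)
    (L2.integrable_inner (𝕜 := ℝ) _ _) ?_
  filter_upwards [(ContinuousLinearMap.lsmul ℝ ℝ).coeFn_holder (r := 2) u v, hu] with x hx hux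
  have : mulL Ω u v x = u x • v x := hx
  rw [this, real_inner_smul_left, real_inner_self_eq_norm_sq]
  exact mul_le_mul_of_nonneg_right hux (sq_nonneg _)

/-- The gradient on `H¹₀(Ω)`. -/
def gradL0 (Ω : Set (EuclideanSpace ℝ (Fin d))) : H10 Ω →L[ℝ] L2vec Ω :=
  (gradL Ω).comp (H10 Ω).subtypeL

/-- The form `z, φ ↦ ∫ u ∇z · ∇φ` is coercive on `H¹₀(Ω)` when `Ω` is bounded and `u ≥ m > 0`. -/
theorem exists_coercive (hd : 1 ≤ d) (hΩb : Bornology.IsBounded Ω) {m : ℝ} (hm : 0 < m)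
    {u : Linf Ω} (hu : ∀ᵐ x ∂vol Ω, m ≤ u x) :
    ∃ c : ℝ, 0 < c ∧ ∀ z : H10 Ω, c * ‖z‖ ^ 2 ≤ inner ℝ (mulL Ω u (gradL0 Ω z)) (gradL0 Ω z) := by
  obtain ⟨R, hR⟩ := hΩb.exists_norm_le
  have hC : 0 < 4 * R ^ 2 + 1 := by positivity
  -- Poincaré bounds the full norm: `‖z‖² ≤ (4 R² + 1) ‖∇z‖²`.
  refine ⟨m / (4 * R ^ 2 + 1), div_pos hm hC, fun z => ?_⟩
  have h2 := mul_norm_sq_le_inner_mulL hu (H1.grad (z : H1 Ω))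
  have h3 := H10.norm_val_sq_le hd hR z
  have h4 : ‖z‖ ^ 2 = _ := H1.norm_sq_eq (z : H1 Ω)
  refine le_trans ?_ h2
  rw [div_mul_eq_mul_div, div_le_iff₀ hC, h4, mul_assoc]
  exact mul_le_mul_of_nonneg_left (by linarith) hm.le

/-- Adding an element of `H10 Ω` does not change the trace, so only the variational equation for `z`
remains. -/
theorem isState_add_iff (f : Hneg1 Ω) (G : H1 Ω) (u : Linf Ω) (z : H10 Ω) :
    IsState f (trace Ω G) u (G + z) ↔
      ∀ φ : H10 Ω, inner ℝ (mulL Ω u (H1.grad G + gradL0 Ω z)) (gradL0 Ω φ) = f φ := by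
  have ht : trace Ω (G + z) = trace Ω G := by
    rw [map_add, add_eq_left]
    exact (Submodule.Quotient.mk_eq_zero _).2 z.2
  rw [IsState, and_iff_left ht]
  refine forall_congr' fun φ => ?_
  rw [inner_mulL]
  rfl

/-- The control-to-state map: the state equation is uniquely solvable for uniformly positive
coefficients, and the solution depends continuously on the coefficient. -/
theorem exists_stateMap (hd : 1 ≤ d) (hΩb : Bornology.IsBounded Ω) {m : ℝ} (hm : 0 < m)
    (f : Hneg1 Ω) (g : HHalf Ω) :
    ∃ S : Linf Ω → H1 Ω, ∀ u : Linf Ω, (∀ᵐ x ∂vol Ω, m ≤ u x) →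
      ContinuousAt S u ∧ ∀ y, IsState f g u y ↔ y = S u := by
  obtain ⟨G, rfl⟩ := (H10 Ω).mkQ_surjective g
  obtain ⟨S, hS⟩ := exists_continuousAt_solution (V := H10 Ω) (W := L2vec Ω) (X := Linf Ω)
    (gradL0 Ω) (mulL Ω) f (H1.grad G)
  refine ⟨fun u => G + (S u : H10 Ω), fun u hu => ?_⟩
  obtain ⟨c, hc, hcoer⟩ := exists_coercive hd hΩb hm hu
  obtain ⟨hcont, hsol⟩ := hS u c hc hcoer
  refine ⟨continuousAt_const.add (continuous_subtype_val.continuousAt.comp hcont), fun y => ?_⟩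
  constructor
  · intro h
    have hmem : y - G ∈ H10 Ω := (Submodule.Quotient.eq _).1 h.2
    have hy : y = G + ((⟨y - G, hmem⟩ : H10 Ω) : H1 Ω) := by simp
    have := (hsol _).1 ((isState_add_iff f G u ⟨y - G, hmem⟩).1 (hy ▸ h))
    exact hy.trans (by rw [this])
  · rintro rfl
    exact (isState_add_iff f G u _).2 ((hsol _).2 rfl)

/-! ### Compactness of the control set -/

/-- The interval `[m, M]` is the ball about its midpoint with radius half its length; the pointwise
constraint thus becomes a norm constraint. -/
theorem mem_admissible_iff_norm_sub_le [IsFiniteMeasure (vol Ω)] (F : Submodule ℝ (Linf Ω))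
    {m M : ℝ} (hmM : m ≤ M) (u : F) :
    u ∈ admissible F m M ↔ ‖(u : Linf Ω) - Lp.const ∞ (vol Ω) ((m + M) / 2)‖ ≤ (M - m) / 2 := by
  have hae : ∀ᵐ x ∂vol Ω, ((u : Linf Ω) - Lp.const ∞ (vol Ω) ((m + M) / 2) : Linf Ω) x =
      (u : Linf Ω) x - (m + M) / 2 := by
    filter_upwards [Lp.coeFn_sub (u : Linf Ω) (Lp.const ∞ (vol Ω) ((m + M) / 2)),
      Lp.coeFn_const (p := ∞) (μ := vol Ω) ((m + M) / 2)] with x h1 h2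
    rw [h1, Pi.sub_apply, h2]
    rfl
  constructor
  · intro h
    have := Lp.norm_le_of_ae_bound (f := (u : Linf Ω) - Lp.const ∞ (vol Ω) ((m + M) / 2))
      (C := (M - m) / 2) (by linarith) (by
        filter_upwards [h, hae] with x hx h'
        rw [h', Real.norm_eq_abs, abs_le]
        constructor <;> linarith [hx.1, hx.2])
    -- The bound carries a factor `μ(Ω)` to the power `∞.toReal⁻¹ = 0`, which is `1`.
    simpa using this
  · intro h
    have hb : ∀ᵐ x ∂vol Ω, ‖((u : Linf Ω) - Lp.const ∞ (vol Ω) ((m + M) / 2) : Linf Ω) x‖ ≤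
        ‖(u : Linf Ω) - Lp.const ∞ (vol Ω) ((m + M) / 2)‖ := by
      filter_upwards [enorm_ae_le_eLpNormEssSup
        ((u : Linf Ω) - Lp.const ∞ (vol Ω) ((m + M) / 2) : Linf Ω) (vol Ω)] with x hx
      rw [Lp.norm_def, eLpNorm_exponent_top, ← toReal_enorm]
      refine ENNReal.toReal_mono ?_ hx
      rw [← eLpNorm_exponent_top]
      exact Lp.eLpNorm_ne_top _
    filter_upwards [hb, hae] with x hx h'
    rw [h', Real.norm_eq_abs] at hx
    have := abs_le.1 (hx.trans h)
    constructor <;> linarith [this.1, this.2]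

theorem isCompact_admissible (hΩb : Bornology.IsBounded Ω) (F : Submodule ℝ (Linf Ω))
    [FiniteDimensional ℝ F] {m M : ℝ} (hmM : m ≤ M) : IsCompact (admissible F m M) := by
  have : IsFiniteMeasure (vol Ω) := ⟨by
    rw [Measure.restrict_apply_univ]
    exact hΩb.measure_lt_top⟩
  have : ProperSpace F := FiniteDimensional.proper ℝ F
  have e : admissible F m M =
      {u : F | ‖(u : Linf Ω) - Lp.const ∞ (vol Ω) ((m + M) / 2)‖ ≤ (M - m) / 2} :=
    Set.ext fun u => mem_admissible_iff_norm_sub_le F hmM u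
  rw [e]
  refine Metric.isCompact_of_isClosed_isBounded
    (isClosed_le (continuous_subtype_val.sub continuous_const).norm continuous_const) ?_
  refine isBounded_iff_forall_norm_le.2
    ⟨(M - m) / 2 + ‖(Lp.const ∞ (vol Ω) ((m + M) / 2) : Linf Ω)‖, fun u hu => ?_⟩
  have := norm_sub_norm_le (u : Linf Ω) (Lp.const ∞ (vol Ω) ((m + M) / 2))
  have hu' : ‖(u : Linf Ω) - Lp.const ∞ (vol Ω) ((m + M) / 2)‖ ≤ (M - m) / 2 := hu
  rw [Submodule.norm_coe] at this
  linarith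

/-! ### Continuity of the network -/

theorem continuous_partialNetwork {N : ℕ} {n : ℕ → ℕ} {ρ : ℝ → ℝ} (hρ : Continuous ρ)
    (w : Weights N n) (l : ℕ) (hl : l < N) : Continuous (partialNetwork ρ w l hl) := by
  induction l with
  | zero => exact (w ⟨0, hl⟩).continuous_of_finiteDimensional
  | succ l ih =>
    exact (w ⟨l + 1, hl⟩).continuous_of_finiteDimensional.comp
      (continuous_pi fun i => hρ.comp ((continuous_apply i).comp (ih _)))

theorem continuous_regularizer {F : Submodule ℝ (Linf Ω)} {L : ℕ} {n : ℕ → ℕ}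
    (b : Module.Basis (Fin (n 0)) ℝ F) {ρ : ℝ → ℝ} (hρ : Continuous ρ) (w : Weights (L + 1) n) :
    Continuous (regularizer b ρ w) := by
  have : FiniteDimensional ℝ F := b.finiteDimensional_of_finite
  exact (continuous_partialNetwork hρ w L (Nat.lt_succ_self L)).comp
    (b.equivFun : F →ₗ[ℝ] Fin (n 0) → ℝ).continuous_of_finiteDimensional

end Conductivity

end

/-! ### Existence of a minimizer -/

theorem mainTheorem9 {d : ℕ} (hd : 1 ≤ d) (Ω : Set (EuclideanSpace ℝ (Fin d)))
    (hΩ : IsOpen Ω) (hΩb : Bornology.IsBounded Ω)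
    (m M : ℝ) (hm : 0 < m) (hmM : m < M)
    (L : ℕ) (n : ℕ → ℕ)
    (F : Submodule ℝ (Conductivity.Linf Ω)) (b : Module.Basis (Fin (n 0)) ℝ F)
    (hU : (Conductivity.admissible F m M).Nonempty)
    (f : Conductivity.Hneg1 Ω) (g : Conductivity.HHalf Ω) (yd : Conductivity.L2 Ω)
    (ρ : ℝ → ℝ) (hρ : ContDiff ℝ 2 ρ)
    (γ : (Fin (n (L + 1)) → ℝ) → ℝ) (hγ : Continuous γ)
    (w : Conductivity.Weights (L + 1) n) :
    ∃ p ∈ Conductivity.feasible F m M f g,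
      IsMinOn (Conductivity.cost b ρ γ yd w) (Conductivity.feasible F m M f g) p := by
  have : FiniteDimensional ℝ F := b.finiteDimensional_of_finite
  obtain ⟨S, hS⟩ := Conductivity.exists_stateMap hd hΩb hm f g
  have hS' : ∀ u ∈ Conductivity.admissible F m M,
      ContinuousAt S (u : Conductivity.Linf Ω) ∧
        ∀ y, Conductivity.IsState f g (u : Conductivity.Linf Ω) y ↔ y = S u := fun u hu =>
    hS u (Filter.Eventually.mono hu fun _ h => h.1)
  have hcont : ContinuousOn (fun u : F => Conductivity.cost b ρ γ yd w (S u, u))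
      (Conductivity.admissible F m M) := by
    intro u hu
    refine ContinuousAt.continuousWithinAt ?_
    have h1 : ContinuousAt (fun u : F => S (u : Conductivity.Linf Ω)) u :=
      ContinuousAt.comp (g := S) (hS' u hu).1 continuous_subtype_val.continuousAt
    have h2 := (Conductivity.valL Ω).continuous.continuousAt.comp h1
    exact (continuousAt_const.mul ((h2.sub continuousAt_const).norm.pow 2)).add
      (hγ.comp (Conductivity.continuous_regularizer b hρ.continuous w)).continuousAt
  obtain ⟨u, hu, hmin⟩ :=
    (Conductivity.isCompact_admissible hΩb F hmM.le).exists_isMinOn hU hcont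
  refine ⟨(S u, u), ⟨hu, ((hS' u hu).2 _).2 rfl⟩, ?_⟩
  rintro ⟨y, v⟩ ⟨hv, hy⟩
  -- By uniqueness of the state, every feasible pair lies on the graph of `S`, so minimality of the
  -- reduced cost suffices.
  obtain rfl := ((hS' v hv).2 y).1 hy
  exact hmin hv
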